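/- A quantaloid is a category whose hom-sets are complete lattices and whose composition preserves joins in each variable. A homomorphism of quantaloids is a functor preserving all joins of arrows, and an equivalence of quantaloids is a homomorphism whose underlying functor is an equivalence of categories. Let $\mathcal Q$ be a small quantaloid. For arrows $u:p\to q$ and $w:p\to r$, let $w\swarrow u:q\to r$ be the largest $v$ with $v\circ u\le w$. A $\mathcal Q$-category $\mathbb X$ consists of a set $\mathbb X_0$ whose elements $x$ have types $|x|\in\mathrm{ob}\,\mathcal Q$, and arrows $\mathbb X(x,y):|x|\to|y|$ with $1_{|x|}\le\mathbb X(x,x)$ and $\mathbb X(y,z)\circ\mathbb X(x,y)\le\mathbb X(x,z)$. Its underlying preorder is: $x\le y$ iff $|x|=|y|$ and $1_{|x|}\le\mathbb X(x,y)$; $\mathbb X$ is separated if this is a partial order. A $\mathcal Q$-functor $f:\mathbb X\to\mathbb Y$ is a type-preserving map with $\mathbb X(x,x')\le\mathbb Y(fx,fx')$; $\mathcal Q$-functors are (pre)ordered pointwise. A $\mathcal Q$-distributor $\phi:\mathbb X\nrightarrow\mathbb Y$ is a family $\phi(x,y):|x|\to|y|$ with $\mathbb Y(y,y')\circ\phi(x,y)\circ\mathbb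 X(x',x)\le\phi(x',y')$; distributors are ordered pointwise, composed by $(\psi\circ\phi)(x,z)=\bigvee_y\psi(y,z)\circ\phi(x,y)$, and the identity on $\mathbb X$ is $(x,x')\mapsto\mathbb X(x,x')$. A presheaf $\mu$ of type $q$ on $\mathbb X$ is a family $\mu(x):|x|\to q$ with $\mu(x)\circ\mathbb X(x',x)\le\mu(x')$. Presheaves form a separated $\mathcal Q$-category $\mathsf P\mathbb X$ with $\mathsf P\mathbb X(\mu,\nu)=\bigwedge_x\nu(x)\swarrow\mu(x)$, and $\mathsf y_{\mathbb X}:\mathbb X\to\mathsf P\mathbb X$, $x\mapsto\mathbb X(-,x)$. A distributor $\phi:\mathbb X\nrightarrow\mathbb Y$ induces $\phi^*:\mathsf P\mathbb Y\to\mathsf P\mathbb X$, $(\phi^*\lambda)(x)=\bigvee_y\lambda(y)\circ\phi(x,y)$. A $\mathcal Q$-functor $f:\mathbb X\to\mathbb Y$ has a cograph $f^\natural:\mathbb Y\nrightarrow\mathbb X$, $f^\natural(y,x)=\mathbb Y(y,fx)$. A supremum of a presheaf $\mu$ on $\mathbb X$ is an $s\in\mathbb X_0$ of the same type with $\mathbb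 X(s,y)=\bigwedge_x\mathbb X(x,y)\swarrow\mu(x)$ for all $y$; $\mathbb X$ is complete if every presheaf on it has a supremum. $\mathcal Q\text{-}\mathbf{Sup}$ is the quantaloid of separated complete $\mathcal Q$-categories and sup-preserving $\mathcal Q$-functors (those with $f(\sup\mu)=\sup\,(f^\natural)^*\mu$ for all presheaves $\mu$), ordered pointwise. A $\mathcal Q$-closure space $(\mathbb X,c)$ is a $\mathcal Q$-category $\mathbb X$ with a $\mathcal Q$-functor $c:\mathsf P\mathbb X\to\mathsf P\mathbb X$ such that $1\le c$ and $cc\le c$. A presheaf $\mu$ is closed if $c\mu=\mu$, and $\mathsf C(\mathbb X,c)$ is the full $\mathcal Q$-subcategory of $\mathsf P\mathbb X$ on the closed presheaves; it is separated and complete. A continuous distributor $\zeta:(\mathbb X,c)\nrightarrow(\mathbb Y,d)$ is a distributor $\zeta:\mathbb X\nrightarrow\mathbb Y$ with $\zeta^*d\le c\,\zeta^*$; these are the arrows of a quantaloid $\mathcal Q\text{-}\mathbf{ClsDist}$, with the composition and order of distributors. The closure of $\zeta$ is the continuous distributor $\mathrm{cl}\,\zeta$ with $(\mathrm{cl}\,\zeta)(-,y)=c(\zeta(-,y))$,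 and $\zeta$ is closed if $\mathrm{cl}\,\zeta=\zeta$, that is, if every presheaf $\zeta(-,y)$ is closed. The operation $\mathrm{cl}$ is a nucleus on $\mathcal Q\text{-}\mathbf{ClsDist}$ (a closure operator on each hom-set with $\mathrm{cl}\,\eta\circ\mathrm{cl}\,\zeta\le\mathrm{cl}(\eta\circ\zeta)$), and $\mathcal Q\text{-}\mathbf{ClsCloDist}$ is the corresponding quotient quantaloid: its objects are the $\mathcal Q$-closure spaces, its arrows the closed continuous distributors, with the inherited order, composition $\mathrm{cl}(\eta\circ\zeta)$, identities $\mathrm{cl}(1)$ and joins $\mathrm{cl}(\bigvee_i\zeta_i)$. Let $\mathsf C_{cl}:(\mathcal Q\text{-}\mathbf{ClsCloDist})^{op}\to\mathcal Q\text{-}\mathbf{Sup}$ be the functor sending $(\mathbb X,c)$ to $\mathsf C(\mathbb X,c)$ and a closed continuous distributor $\zeta:(\mathbb X,c)\nrightarrow(\mathbb Y,d)$ to the sup-preserving $\mathcal Q$-functor $\mathsf C(\mathbb Y,d)\to\mathsf C(\mathbb X,c)$, $\lambda\mapsto c(\zeta^*\lambda)$. Let $\mathsf I_{cl}:\mathcal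 Q\text{-}\mathbf{Sup}\to(\mathcal Q\text{-}\mathbf{ClsCloDist})^{op}$ be the functor sending $\mathbb X$ to $(\mathbb X,c_{\mathbb X})$, where $c_{\mathbb X}=\mathsf y_{\mathbb X}\circ\sup_{\mathbb X}$, and $f:\mathbb X\to\mathbb Y$ to $\mathrm{cl}(f^\natural):(\mathbb Y,c_{\mathbb Y})\nrightarrow(\mathbb X,c_{\mathbb X})$. **Theorem.** For every small quantaloid $\mathcal Q$, the functors $\mathsf C_{cl}$ and $\mathsf I_{cl}$ are homomorphisms of quantaloids, and they are mutually quasi-inverse equivalences of categories. Thus they establish an equivalence of quantaloids $(\mathcal Q\text{-}\mathbf{ClsCloDist})^{op}\simeq\mathcal Q\text{-}\mathbf{Sup}$, so $\mathcal Q\text{-}\mathbf{ClsCloDist}$ and $\mathcal Q\text{-}\mathbf{Sup}$ are dually equivalent quantaloids. -/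

import Mathlib

open CategoryTheory

universe u v w

namespace QClosure

noncomputable section

/-! ### Quantaloids

Composition is written in diagrammatic order: `u ≫ v` is the arrow usually written `v ∘ u`. -/

/-- A quantaloid: a category whose hom-sets are complete lattices and whose composition preserves
joins in each variable. -/
class Quantaloid (C : Type w) [Category.{v} C] where
  [lattice : ∀ p q : C, CompleteLattice (p ⟶ q)]
  comp_sSup : ∀ {p q r : C} (u : p ⟶ q) (S : Set (q ⟶ r)), u ≫ sSup S = ⨆ v ∈ S, u ≫ v
  sSup_comp : ∀ {p q r : C} (S : Set (p ⟶ q)) (v : q ⟶ r), sSup S ≫ v = ⨆ u ∈ S, u ≫ v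

attribute [reducible, instance] Quantaloid.lattice

/-- A homomorphism of quantaloids: a functor that preserves all joins of arrows. -/
def IsQuantaloidHom {C : Type*} [Category C] [Quantaloid C] {D : Type*} [Category D]
    [Quantaloid D] (F : C ⥤ D) : Prop :=
  ∀ (p q : C) (S : Set (p ⟶ q)), F.map (sSup S) = sSup ((fun u => F.map u) '' S)

section Basic

variable {C : Type w} [Category.{v} C] [Quantaloid C]

theorem comp_iSup {ι : Sort*} {p q r : C} (u : p ⟶ q) (f : ι → (q ⟶ r)) :
    u ≫ (⨆ i, f i) = ⨆ i, u ≫ f i := by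
  rw [iSup, Quantaloid.comp_sSup, iSup_range]

theorem iSup_comp {ι : Sort*} {p q r : C} (f : ι → (p ⟶ q)) (v : q ⟶ r) :
    (⨆ i, f i) ≫ v = ⨆ i, f i ≫ v := by
  rw [iSup, Quantaloid.sSup_comp, iSup_range]

theorem comp_mono {p q r : C} {u u' : p ⟶ q} {v v' : q ⟶ r} (h : u ≤ u') (k : v ≤ v') :
    u ≫ v ≤ u' ≫ v' := by
  have h1 : u ≫ v ≤ u' ≫ v := by
    have := Quantaloid.sSup_comp {u, u'} v
    rw [sSup_pair, sup_eq_right.2 h] at this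
    rw [this]
    exact le_iSup₂_of_le u (by simp) le_rfl
  have h2 : u' ≫ v ≤ u' ≫ v' := by
    have := Quantaloid.comp_sSup u' {v, v'}
    rw [sSup_pair, sup_eq_right.2 k] at this
    rw [this]
    exact le_iSup₂_of_le v (by simp) le_rfl
  exact h1.trans h2

/-- The left implication `w ↙ u` of `u : p ⟶ q` and `w : p ⟶ r`: the largest `v : q ⟶ r` with
`v ∘ u ≤ w`. -/
def lda {p q r : C} (w : p ⟶ r) (u : p ⟶ q) : q ⟶ r := sSup {v | u ≫ v ≤ w}

theorem le_lda {p q r : C} {w : p ⟶ r} {u : p ⟶ q} {v : q ⟶ r} :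
    v ≤ lda w u ↔ u ≫ v ≤ w := by
  constructor
  · intro h
    refine (comp_mono le_rfl h).trans ?_
    rw [lda, Quantaloid.comp_sSup]
    exact iSup₂_le fun v hv => hv
  · intro h
    exact le_sSup h

/-- The local order of the opposite of a quantaloid is that of the quantaloid. -/
instance opLattice (p q : Cᵒᵖ) : CompleteLattice (p ⟶ q) :=
  letI : PartialOrder (p ⟶ q) := PartialOrder.lift Quiver.Hom.unop Quiver.Hom.unop_inj
  letI : SupSet (p ⟶ q) := ⟨fun S => (sSup (Quiver.Hom.unop '' S)).op⟩
  completeLatticeOfSup (p ⟶ q) fun S => by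
    constructor
    · intro u hu
      exact le_sSup (Set.mem_image_of_mem _ hu)
    · intro u hu
      refine sSup_le (a := u.unop) ?_
      rintro _ ⟨v, hv, rfl⟩
      exact hu hv

theorem unop_le {p q : Cᵒᵖ} {u v : p ⟶ q} : u ≤ v ↔ u.unop ≤ v.unop := Iff.rfl

theorem unop_sSup {p q : Cᵒᵖ} (S : Set (p ⟶ q)) :
    (sSup S).unop = sSup (Quiver.Hom.unop '' S) := rfl

/-- The opposite of a quantaloid. -/
instance : Quantaloid Cᵒᵖ where
  comp_sSup u S := by
    apply le_antisymm
    · rw [unop_le, unop_comp, unop_sSup, Quantaloid.sSup_comp]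
      refine iSup₂_le ?_
      rintro _ ⟨v, hv, rfl⟩
      exact unop_le.1 (le_iSup₂_of_le (f := fun v (_ : v ∈ S) => u ≫ v) v hv le_rfl)
    · refine iSup₂_le fun v hv => ?_
      rw [unop_le, unop_comp, unop_comp]
      exact comp_mono (unop_le.1 (le_sSup hv)) le_rfl
  sSup_comp S v := by
    apply le_antisymm
    · rw [unop_le, unop_comp, unop_sSup, Quantaloid.comp_sSup]
      refine iSup₂_le ?_
      rintro _ ⟨u, hu, rfl⟩
      exact unop_le.1 (le_iSup₂_of_le (f := fun u (_ : u ∈ S) => u ≫ v) u hu le_rfl)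
    · refine iSup₂_le fun u hu => ?_
      rw [unop_le, unop_comp, unop_comp]
      exact comp_mono le_rfl (unop_le.1 (le_sSup hu))

/-! ### Nuclei and quotient quantaloids -/

variable (C) in
/-- A nucleus on a quantaloid: a closure operator on each hom-set, lax with respect to
composition. -/
structure Nucleus where
  cl : ∀ {p q : C}, (p ⟶ q) → (p ⟶ q)
  mono : ∀ {p q : C} {u u' : p ⟶ q}, u ≤ u' → cl u ≤ cl u'
  le_cl : ∀ {p q : C} (u : p ⟶ q), u ≤ cl u
  cl_cl : ∀ {p q : C} (u : p ⟶ q), cl (cl u) = cl u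
  cl_comp_cl : ∀ {p q r : C} (u : p ⟶ q) (v : q ⟶ r), cl u ≫ cl v ≤ cl (u ≫ v)

namespace Nucleus

variable (j : Nucleus C)

theorem cl_comp_left {p q r : C} (u : p ⟶ q) (v : q ⟶ r) :
    j.cl (j.cl u ≫ v) = j.cl (u ≫ v) := by
  apply le_antisymm
  · rw [← j.cl_cl (u ≫ v)]
    exact j.mono ((comp_mono le_rfl (j.le_cl v)).trans (j.cl_comp_cl u v))
  · exact j.mono (comp_mono (j.le_cl u) le_rfl)

theorem cl_comp_right {p q r : C} (u : p ⟶ q) (v : q ⟶ r) :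
    j.cl (u ≫ j.cl v) = j.cl (u ≫ v) := by
  apply le_antisymm
  · rw [← j.cl_cl (u ≫ v)]
    exact j.mono ((comp_mono (j.le_cl u) le_rfl).trans (j.cl_comp_cl u v))
  · exact j.mono (comp_mono le_rfl (j.le_cl v))

/-- Objects of the quotient quantaloid of a nucleus: those of the original quantaloid. -/
structure Quotient (j : Nucleus C) where
  of : C

/-- The arrows of the quotient quantaloid are the fixed points of the nucleus, the identities are
`j (𝟙 p)`, and the composite is `j (u ≫ v)`. -/
instance : Category.{v} j.Quotient where
  Hom p q := {u : p.of ⟶ q.of // j.cl u = u}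
  id p := ⟨j.cl (𝟙 p.of), j.cl_cl _⟩
  comp u v := ⟨j.cl (u.1 ≫ v.1), j.cl_cl _⟩
  id_comp u := Subtype.ext (by
    change j.cl (j.cl (𝟙 _) ≫ u.1) = u.1
    rw [cl_comp_left, Category.id_comp, u.2])
  comp_id u := Subtype.ext (by
    change j.cl (u.1 ≫ j.cl (𝟙 _)) = u.1
    rw [cl_comp_right, Category.comp_id, u.2])
  assoc u v x := Subtype.ext (by
    change j.cl (j.cl (u.1 ≫ v.1) ≫ x.1) = j.cl (u.1 ≫ j.cl (v.1 ≫ x.1))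
    rw [cl_comp_left, cl_comp_right, Category.assoc])

/-- The local order of the quotient quantaloid is that of the original one, and the join of a set
of fixed points is `j` of their join. -/
instance : Quantaloid j.Quotient where
  lattice p q :=
    letI : PartialOrder (p ⟶ q) := inferInstanceAs (PartialOrder {u : p.of ⟶ q.of // j.cl u = u})
    letI : SupSet (p ⟶ q) := ⟨fun S => ⟨j.cl (sSup (Subtype.val '' S)), j.cl_cl _⟩⟩
    completeLatticeOfSup (p ⟶ q) fun S => by
      constructor
      · intro u hu
        exact (le_sSup (Set.mem_image_of_mem _ hu)).trans (j.le_cl _)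
      · intro u hu
        change j.cl (sSup (Subtype.val '' S)) ≤ u.1
        rw [← u.2]
        refine j.mono (sSup_le ?_)
        rintro _ ⟨v, hv, rfl⟩
        exact hu hv
  comp_sSup {p q r} u S := by
    apply Subtype.ext
    change j.cl (u.1 ≫ j.cl (sSup (Subtype.val '' S))) = j.cl (sSup _)
    rw [cl_comp_right, Quantaloid.comp_sSup]
    apply le_antisymm
    · refine j.mono (iSup₂_le ?_)
      rintro _ ⟨v, hv, rfl⟩
      refine le_sSup_of_le ⟨_, ⟨v, rfl⟩, rfl⟩ ?_
      refine le_trans ?_ (j.le_cl _)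
      exact le_sSup_of_le ⟨_, ⟨hv, rfl⟩, rfl⟩ (j.le_cl (u.1 ≫ v.1))
    · rw [← j.cl_cl (⨆ v ∈ _, _)]
      refine j.mono (sSup_le ?_)
      rintro _ ⟨_, ⟨v, rfl⟩, rfl⟩
      refine j.mono (sSup_le ?_) |>.trans_eq (j.cl_cl _)
      rintro _ ⟨_, ⟨hv, rfl⟩, rfl⟩
      exact j.mono (le_iSup₂_of_le v.1 ⟨v, hv, rfl⟩ le_rfl)
  sSup_comp {p q r} S v := by
    apply Subtype.ext
    change j.cl (j.cl (sSup (Subtype.val '' S)) ≫ v.1) = j.cl (sSup _)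
    rw [cl_comp_left, Quantaloid.sSup_comp]
    apply le_antisymm
    · refine j.mono (iSup₂_le ?_)
      rintro _ ⟨u, hu, rfl⟩
      refine le_sSup_of_le ⟨_, ⟨u, rfl⟩, rfl⟩ ?_
      refine le_trans ?_ (j.le_cl _)
      exact le_sSup_of_le ⟨_, ⟨hu, rfl⟩, rfl⟩ (j.le_cl (u.1 ≫ v.1))
    · rw [← j.cl_cl (⨆ u ∈ _, _)]
      refine j.mono (sSup_le ?_)
      rintro _ ⟨_, ⟨u, rfl⟩, rfl⟩
      refine j.mono (sSup_le ?_) |>.trans_eq (j.cl_cl _)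
      rintro _ ⟨_, ⟨hu, rfl⟩, rfl⟩
      exact j.mono (le_iSup₂_of_le u.1 ⟨u, hu, rfl⟩ le_rfl)

/-- The quotient homomorphism `u ↦ j u`. -/
def proj : C ⥤ j.Quotient where
  obj p := ⟨p⟩
  map u := ⟨j.cl u, j.cl_cl u⟩
  map_id _ := rfl
  map_comp u v := Subtype.ext (by
    change j.cl (u ≫ v) = j.cl (j.cl u ≫ j.cl v)
    rw [cl_comp_left, cl_comp_right])

/-- A contravariant functor that does not distinguish `u` from `j u` factors through the quotient
homomorphism `proj`; the factor sends a fixed point `u` to `F u`. -/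
def liftOp {D : Type*} [Category D] (F : Cᵒᵖ ⥤ D)
    (h : ∀ {p q : C} (u : p ⟶ q), F.map (j.cl u).op = F.map u.op) : j.Quotientᵒᵖ ⥤ D where
  obj p := F.obj (Opposite.op p.unop.of)
  map u := F.map u.unop.1.op
  map_id p := (h (𝟙 p.unop.of)).trans (F.map_id (Opposite.op p.unop.of))
  map_comp u v := (h (v.unop.1 ≫ u.unop.1)).trans (F.map_comp u.unop.1.op v.unop.1.op)

/-- The factorization of `F` through the quotient homomorphism. -/
theorem liftOp_map_proj {D : Type*} [Category D] (F : Cᵒᵖ ⥤ D)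
    (h : ∀ {p q : C} (u : p ⟶ q), F.map (j.cl u).op = F.map u.op) {p q : C} (u : p ⟶ q) :
    (j.liftOp F h).map (j.proj.map u).op = F.map u.op := h u

end Nucleus

end Basic

/-! ### Categories, functors and distributors enriched in a small quantaloid

A set `X` typed over the objects of `Q` is given by its fibres, the sets `X.obj q` of elements of
type `q`; a type-preserving map is a family of maps between fibres. -/

variable (Q : Type u) [SmallCategory Q] [Quantaloid Q]

/-- A (small) `Q`-category. -/
structure QCat where
  obj : Q → Type u
  hom : ∀ {p q : Q}, obj p → obj q → (p ⟶ q)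
  id_le : ∀ {p : Q} (x : obj p), 𝟙 p ≤ hom x x
  comp_le : ∀ {p q r : Q} (x : obj p) (y : obj q) (z : obj r), hom x y ≫ hom y z ≤ hom x z

variable {Q}

namespace QCat

/-- The underlying preorder: `x ≤ y` when `x` and `y` have the same type `q` and
`1_q ≤ X(x, y)`. -/
def Le (X : QCat Q) {q : Q} (x y : X.obj q) : Prop := 𝟙 q ≤ X.hom x y

/-- Separated (skeletal) `Q`-categories. -/
def Separated (X : QCat Q) : Prop :=
  ∀ {q : Q} (x y : X.obj q), X.Le x y → X.Le y x → x = y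

end QCat

/-- `Q`-functors. -/
@[ext]
structure QFunctor (X Y : QCat Q) where
  map : ∀ {q : Q}, X.obj q → Y.obj q
  hom_le : ∀ {p q : Q} (x : X.obj p) (x' : X.obj q), X.hom x x' ≤ Y.hom (map x) (map x')

namespace QFunctor

/-- The pointwise preorder of `Q`-functors. -/
def Le {X Y : QCat Q} (f g : QFunctor X Y) : Prop :=
  ∀ ⦃q : Q⦄ (x : X.obj q), Y.Le (f.map x) (g.map x)

/-- The identity `Q`-functor. -/
def id (X : QCat Q) : QFunctor X X where
  map x := x
  hom_le _ _ := le_rfl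

/-- `f.comp g` is `f` followed by `g`. -/
def comp {X Y Z : QCat Q} (f : QFunctor X Y) (g : QFunctor Y Z) : QFunctor X Z where
  map x := g.map (f.map x)
  hom_le x x' := (f.hom_le x x').trans (g.hom_le _ _)

end QFunctor

/-- `Q`-distributors from `X` to `Y`. -/
@[ext]
structure Dist (X Y : QCat Q) where
  rel : ∀ {p q : Q}, X.obj p → Y.obj q → (p ⟶ q)
  comp_le : ∀ {p p' q q' : Q} (x : X.obj p) (x' : X.obj p') (y : Y.obj q) (y' : Y.obj q'),
    X.hom x' x ≫ rel x y ≫ Y.hom y y' ≤ rel x' y'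

/-- Presheaves of type `q` on `X`, that is, `Q`-distributors from `X` to the `Q`-category with a
single object, which has type `q` and hom-arrow `1_q`. -/
@[ext]
structure Presheaf (X : QCat Q) (q : Q) where
  val : ∀ {p : Q}, X.obj p → (p ⟶ q)
  comp_le : ∀ {p p' : Q} (x : X.obj p) (x' : X.obj p'), X.hom x' x ≫ val x ≤ val x'

namespace Presheaf

variable {X : QCat Q}

/-- Presheaves of the same type are ordered pointwise. -/
instance {q : Q} : PartialOrder (Presheaf X q) where
  le μ ν := ∀ ⦃p : Q⦄ (x : X.obj p), μ.val x ≤ ν.val x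
  le_refl _ _ _ := le_rfl
  le_trans _ _ _ h k _ x := (h x).trans (k x)
  le_antisymm _ _ h k := by
    ext p x
    exact le_antisymm (h x) (k x)

end Presheaf

/-- The hom-arrow `PX(μ, ν) = ⋀ x, ν x ↙ μ x`. -/
def presheafHom {X : QCat Q} {p q : Q} (μ : Presheaf X p) (ν : Presheaf X q) : p ⟶ q :=
  ⨅ (r : Q) (x : X.obj r), lda (ν.val x) (μ.val x)

theorem le_presheafHom {X : QCat Q} {p q : Q} {μ : Presheaf X p} {ν : Presheaf X q} {v : p ⟶ q} :
    v ≤ presheafHom μ ν ↔ ∀ {r : Q} (x : X.obj r), μ.val x ≫ v ≤ ν.val x := by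
  simp only [presheafHom, le_iInf_iff, le_lda]

/-- The `Q`-category `PX` of presheaves on `X`. -/
abbrev presheafCat (X : QCat Q) : QCat Q where
  obj q := Presheaf X q
  hom μ ν := presheafHom μ ν
  id_le μ := le_presheafHom.2 fun x => by simp
  comp_le μ ν ξ := le_presheafHom.2 fun x => by
    rw [← Category.assoc]
    exact (comp_mono (le_presheafHom.1 le_rfl x) le_rfl).trans (le_presheafHom.1 le_rfl x)

theorem presheafCat_le_iff {X : QCat Q} {q : Q} {μ ν : Presheaf X q} :
    (presheafCat X).Le μ ν ↔ μ ≤ ν := by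
  refine (le_presheafHom (v := 𝟙 q)).trans ?_
  simp only [Category.comp_id]
  rfl

namespace QCat

variable (X : QCat Q)

/-- The Yoneda embedding `x ↦ X(-, x)`. -/
def yoneda : QFunctor X (presheafCat X) where
  map {q} x := ({ val := fun y => X.hom y x, comp_le := fun y y' => X.comp_le y' y x } :
    Presheaf X q)
  hom_le x x' := le_presheafHom.2 fun y => X.comp_le y x x'

/-- `s` is a supremum of the presheaf `μ`: `X(s, -) = X ↙ μ`. -/
def IsSup {q : Q} (μ : Presheaf X q) (s : X.obj q) : Prop :=
  ∀ {r : Q} (y : X.obj r), X.hom s y = ⨅ (p : Q) (x : X.obj p), lda (X.hom x y) (μ.val x)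

/-- A `Q`-category is complete if every presheaf has a supremum. -/
def Complete : Prop := ∀ {q : Q} (μ : Presheaf X q), ∃ s : X.obj q, X.IsSup μ s

variable {X}

theorem isSup_iff {q : Q} {μ : Presheaf X q} {s : X.obj q} :
    X.IsSup μ s ↔ ∀ {r : Q} (y : X.obj r) (v : q ⟶ r),
      v ≤ X.hom s y ↔ ∀ {p : Q} (x : X.obj p), μ.val x ≫ v ≤ X.hom x y := by
  have key : ∀ {r : Q} (y : X.obj r) (v : q ⟶ r),
      v ≤ (⨅ (p : Q) (x : X.obj p), lda (X.hom x y) (μ.val x)) ↔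
        ∀ {p : Q} (x : X.obj p), μ.val x ≫ v ≤ X.hom x y := by
    intro r y v
    simp only [le_iInf_iff, le_lda]
  constructor
  · intro h r y v
    rw [h y]
    exact key y v
  · intro h r y
    exact eq_of_forall_le_iff fun v => (h y v).trans (key y v).symm

theorem IsSup.unique (hX : X.Separated) {q : Q} {μ : Presheaf X q} {s t : X.obj q}
    (hs : X.IsSup μ s) (ht : X.IsSup μ t) : s = t := by
  apply hX
  · exact (X.id_le t).trans_eq ((ht t).trans (hs t).symm)
  · exact (X.id_le s).trans_eq ((hs s).trans (ht s).symm)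

end QCat

namespace Dist

variable {X Y Z : QCat Q}

theorem comp_le_left (φ : Dist X Y) {p p' q : Q} (x : X.obj p) (x' : X.obj p') (y : Y.obj q) :
    X.hom x' x ≫ φ.rel x y ≤ φ.rel x' y := by
  refine le_trans ?_ (φ.comp_le x x' y y)
  refine comp_mono le_rfl ?_
  have := comp_mono (le_refl (φ.rel x y)) (Y.id_le y)
  rwa [Category.comp_id] at this

theorem comp_le_right (φ : Dist X Y) {p q q' : Q} (x : X.obj p) (y : Y.obj q) (y' : Y.obj q') :
    φ.rel x y ≫ Y.hom y y' ≤ φ.rel x y' := by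
  refine le_trans ?_ (φ.comp_le x x y y')
  have := comp_mono (X.id_le x) (le_refl (φ.rel x y ≫ Y.hom y y'))
  rwa [Category.id_comp] at this

/-- The identity distributor on `X` is given by its hom-arrows. -/
def id (X : QCat Q) : Dist X X where
  rel x y := X.hom x y
  comp_le x x' y y' :=
    (comp_mono le_rfl (X.comp_le x y y')).trans (X.comp_le x' x y')

/-- `φ.comp ψ` is the composite usually written `ψ ∘ φ`. -/
def comp (φ : Dist X Y) (ψ : Dist Y Z) : Dist X Z where
  rel x z := ⨆ (q : Q) (y : Y.obj q), φ.rel x y ≫ ψ.rel y z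
  comp_le x x' z z' := by
    simp only [comp_iSup, iSup_comp]
    refine iSup₂_le fun q y => le_iSup₂_of_le q y ?_
    have := comp_mono (φ.comp_le_left x x' y) (ψ.comp_le_right y z z')
    simpa only [Category.assoc] using this

/-- Distributors are ordered pointwise. -/
instance : PartialOrder (Dist X Y) where
  le φ ψ := ∀ ⦃p q : Q⦄ (x : X.obj p) (y : Y.obj q), φ.rel x y ≤ ψ.rel x y
  le_refl _ _ _ _ _ := le_rfl
  le_trans _ _ _ h k _ _ x y := (h x y).trans (k x y)
  le_antisymm _ _ h k := by
    ext p q x y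
    exact le_antisymm (h x y) (k x y)

/-- Pointwise joins of distributors. -/
def sup (S : Set (Dist X Y)) : Dist X Y where
  rel x y := ⨆ φ ∈ S, φ.rel x y
  comp_le x x' y y' := by
    simp only [comp_iSup, iSup_comp]
    exact iSup₂_le fun φ hφ => le_iSup₂_of_le φ hφ (φ.comp_le x x' y y')

/-- The transpose `y ↦ φ(-, y)` of a distributor, a `Q`-functor from `Y` to `PX`. -/
def transpose (φ : Dist X Y) : QFunctor Y (presheafCat X) where
  map {q} y := ({ val := fun x => φ.rel x y, comp_le := fun x x' => φ.comp_le_left x x' y } :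
    Presheaf X q)
  hom_le y y' := le_presheafHom.2 fun x => φ.comp_le_right x y y'

/-- The distributor with a given transpose. -/
def ofTranspose (f : QFunctor Y (presheafCat X)) : Dist X Y where
  rel {_ q} x y := (show Presheaf X q from f.map y).val x
  comp_le x x' y y' := by
    refine le_trans (comp_mono le_rfl ?_) (Presheaf.comp_le _ x x')
    exact le_presheafHom.1 (f.hom_le y y') x

/-- The presheaf `λ ∘ φ` on `X`, for a presheaf `λ` on `Y`. -/
def pull (φ : Dist X Y) {q : Q} (l : Presheaf Y q) : Presheaf X q where
  val x := ⨆ (r : Q) (y : Y.obj r), φ.rel x y ≫ l.val y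
  comp_le x x' := by
    simp only [comp_iSup]
    refine iSup₂_le fun r y => le_iSup₂_of_le r y ?_
    rw [← Category.assoc]
    exact comp_mono (φ.comp_le_left x x' y) le_rfl

/-- The `Q`-functor `φ^* : PY ⟶ PX`, `λ ↦ λ ∘ φ`. -/
def star (φ : Dist X Y) : QFunctor (presheafCat Y) (presheafCat X) where
  map l := φ.pull l
  hom_le l l' := le_presheafHom.2 fun x => by
    change (⨆ (r : Q) (y : Y.obj r), φ.rel x y ≫ l.val y) ≫ _ ≤ _
    simp only [iSup_comp]
    refine iSup₂_le fun r y => le_iSup₂_of_le r y ?_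
    rw [Category.assoc]
    exact comp_mono le_rfl (le_presheafHom.1 le_rfl y)

theorem pull_le_iff (φ : Dist X Y) {q : Q} {l : Presheaf Y q} {μ : Presheaf X q} :
    φ.pull l ≤ μ ↔ ∀ {p r : Q} (x : X.obj p) (y : Y.obj r), φ.rel x y ≫ l.val y ≤ μ.val x := by
  constructor
  · intro h p r x y
    exact (le_iSup₂_of_le r y le_rfl).trans (h x)
  · intro h p x
    exact iSup₂_le fun r y => h x y

theorem le_pull (φ : Dist X Y) {q : Q} (l : Presheaf Y q) {p r : Q} (x : X.obj p) (y : Y.obj r) :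
    φ.rel x y ≫ l.val y ≤ (φ.pull l).val x :=
  φ.pull_le_iff.1 le_rfl x y

theorem pull_mono (φ : Dist X Y) {q : Q} {l l' : Presheaf Y q} (h : l ≤ l') :
    φ.pull l ≤ φ.pull l' :=
  φ.pull_le_iff.2 fun x y => (comp_mono le_rfl (h y)).trans (φ.le_pull l' x y)

theorem pull_mono_left {φ ψ : Dist X Y} (h : φ ≤ ψ) {q : Q} (l : Presheaf Y q) :
    φ.pull l ≤ ψ.pull l :=
  φ.pull_le_iff.2 fun x y => (comp_mono (h x y) le_rfl).trans (ψ.le_pull l x y)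

theorem pull_id {q : Q} (μ : Presheaf X q) : (Dist.id X).pull μ = μ := by
  apply le_antisymm
  · exact (pull_le_iff _).2 fun x y => μ.comp_le y x
  · intro p x
    refine le_trans ?_ (le_pull _ μ x x)
    have := comp_mono (X.id_le x) (le_refl (μ.val x))
    rwa [Category.id_comp] at this

theorem pull_comp (φ : Dist X Y) (ψ : Dist Y Z) {q : Q} (l : Presheaf Z q) :
    (φ.comp ψ).pull l = φ.pull (ψ.pull l) := by
  ext p x
  change (⨆ (r : Q) (z : Z.obj r), (⨆ (s : Q) (y : Y.obj s), φ.rel x y ≫ ψ.rel y z) ≫ l.val z) =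
    ⨆ (s : Q) (y : Y.obj s), φ.rel x y ≫ ⨆ (r : Q) (z : Z.obj r), ψ.rel y z ≫ l.val z
  simp only [comp_iSup, iSup_comp, Category.assoc]
  apply le_antisymm
  · exact iSup₂_le fun r z => iSup₂_le fun s y => le_iSup₂_of_le s y (le_iSup₂_of_le r z le_rfl)
  · exact iSup₂_le fun s y => iSup₂_le fun r z => le_iSup₂_of_le r z (le_iSup₂_of_le s y le_rfl)

end Dist

/-- The cograph `f^♮(y, x) = Y(y, f x)` of a `Q`-functor `f`, a distributor from `Y` to `X`. The
`Q`-functor `f^→ : PX ⟶ PY` is `f.cograph.star`. -/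
def QFunctor.cograph {X Y : QCat Q} (f : QFunctor X Y) : Dist Y X where
  rel y x := Y.hom y (f.map x)
  comp_le y y' x x' := by
    refine le_trans (comp_mono le_rfl (comp_mono le_rfl (f.hom_le x x'))) ?_
    exact (comp_mono le_rfl (Y.comp_le _ _ _)).trans (Y.comp_le _ _ _)

theorem isSup_cograph_iff {X Y : QCat Q} (f : QFunctor X Y) {q : Q} {μ : Presheaf X q}
    {t : Y.obj q} : Y.IsSup (f.cograph.pull μ) t ↔ ∀ {r : Q} (y : Y.obj r) (v : q ⟶ r),
      v ≤ Y.hom t y ↔ ∀ {p : Q} (x : X.obj p), μ.val x ≫ v ≤ Y.hom (f.map x) y := by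
  have key : ∀ {r : Q} (y : Y.obj r) (v : q ⟶ r),
      (∀ {p : Q} (y' : Y.obj p), (f.cograph.pull μ).val y' ≫ v ≤ Y.hom y' y) ↔
        ∀ {p : Q} (x : X.obj p), μ.val x ≫ v ≤ Y.hom (f.map x) y := by
    intro r y v
    constructor
    · intro h p x
      refine le_trans ?_ (h (f.map x))
      refine comp_mono ?_ le_rfl
      refine le_trans ?_ (f.cograph.le_pull μ (f.map x) x)
      have := comp_mono (Y.id_le (f.map x)) (le_refl (μ.val x))
      rwa [Category.id_comp] at this
    · intro h p y'
      change (⨆ (r : Q) (x : X.obj r), Y.hom y' (f.map x) ≫ μ.val x) ≫ v ≤ _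
      simp only [iSup_comp, Category.assoc]
      exact iSup₂_le fun r x => (comp_mono le_rfl (h x)).trans (Y.comp_le _ _ _)
  rw [QCat.isSup_iff]
  constructor
  · intro h r y v
    exact (h y v).trans (key y v)
  · intro h r y v
    exact (h y v).trans (key y v).symm

/-! ### The quantaloid of separated complete `Q`-categories and sup-preserving `Q`-functors -/

variable (Q) in
/-- Separated complete `Q`-categories. -/
structure QSup where
  cat : QCat Q
  separated : cat.Separated
  complete : cat.Complete

namespace QSup

/-- The supremum of a presheaf on a separated complete `Q`-category. -/
def sup (X : QSup Q) {q : Q} (μ : Presheaf X.cat q) : X.cat.obj q :=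
  (X.complete μ).choose

theorem isSup (X : QSup Q) {q : Q} (μ : Presheaf X.cat q) : X.cat.IsSup μ (X.sup μ) :=
  (X.complete μ).choose_spec

theorem sup_eq (X : QSup Q) {q : Q} {μ : Presheaf X.cat q} {s : X.cat.obj q}
    (h : X.cat.IsSup μ s) : X.sup μ = s :=
  QCat.IsSup.unique X.separated (X.isSup μ) h

theorem le_hom_sup (X : QSup Q) {q r : Q} {μ : Presheaf X.cat q} {y : X.cat.obj r} {v : q ⟶ r} :
    v ≤ X.cat.hom (X.sup μ) y ↔ ∀ {p : Q} (x : X.cat.obj p), μ.val x ≫ v ≤ X.cat.hom x y :=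
  QCat.isSup_iff.1 (X.isSup μ) y v

theorem le_sup (X : QSup Q) {q p : Q} (μ : Presheaf X.cat q) (x : X.cat.obj p) :
    μ.val x ≤ X.cat.hom x (X.sup μ) := by
  have := X.le_hom_sup.1 (X.cat.id_le (X.sup μ)) x
  rwa [Category.comp_id] at this

/-- Sup-preserving `Q`-functors: `f (sup μ) = sup (f^→ μ)` for every presheaf `μ`. -/
@[ext]
structure Hom (X Y : QSup Q) where
  functor : QFunctor X.cat Y.cat
  map_sup : ∀ {q : Q} (μ : Presheaf X.cat q),
    functor.map (X.sup μ) = Y.sup (functor.cograph.star.map μ)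

theorem preserves_iff {X Y : QSup Q} (f : QFunctor X.cat Y.cat) :
    (∀ {q : Q} (μ : Presheaf X.cat q), f.map (X.sup μ) = Y.sup (f.cograph.star.map μ)) ↔
      ∀ {q r : Q} (μ : Presheaf X.cat q) (y : Y.cat.obj r) (v : q ⟶ r),
        v ≤ Y.cat.hom (f.map (X.sup μ)) y ↔
          ∀ {p : Q} (x : X.cat.obj p), μ.val x ≫ v ≤ Y.cat.hom (f.map x) y := by
  constructor
  · intro h q r μ y v
    rw [h μ]
    exact (isSup_cograph_iff f).1 (Y.isSup (f.cograph.pull μ)) y v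
  · intro h q μ
    exact (Y.sup_eq ((isSup_cograph_iff f).2 (h μ))).symm

theorem preserves_of_adjoint {X Y : QSup Q} (f : QFunctor X.cat Y.cat)
    (g : ∀ {q : Q}, Y.cat.obj q → X.cat.obj q)
    (h : ∀ {p q : Q} (x : X.cat.obj p) (y : Y.cat.obj q),
      Y.cat.hom (f.map x) y = X.cat.hom x (g y)) {q : Q} (μ : Presheaf X.cat q) :
    f.map (X.sup μ) = Y.sup (f.cograph.star.map μ) :=
  (preserves_iff f).2 (fun μ y v => by simp only [h, X.le_hom_sup]) μ

instance : Category.{u} (QSup Q) where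
  Hom X Y := Hom X Y
  id X := ⟨QFunctor.id X.cat, (preserves_iff (QFunctor.id X.cat)).2 fun _ _ _ => X.le_hom_sup⟩
  comp {X Y Z} f g := ⟨f.functor.comp g.functor, by
    apply (preserves_iff (f.functor.comp g.functor)).2
    intro q r μ z v
    change v ≤ Z.cat.hom (g.functor.map (f.functor.map (X.sup μ))) z ↔ _
    rw [f.map_sup, (preserves_iff g.functor).1 g.map_sup]
    constructor
    · intro h p x
      refine le_trans (comp_mono ?_ le_rfl) (h (f.functor.map x))
      refine le_trans ?_ (f.functor.cograph.le_pull μ (f.functor.map x) x)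
      have := comp_mono (Y.cat.id_le (f.functor.map x)) (le_refl (μ.val x))
      rwa [Category.id_comp] at this
    · intro h p y
      change (⨆ (r : Q) (x : X.cat.obj r), Y.cat.hom y (f.functor.map x) ≫ μ.val x) ≫ v ≤ _
      simp only [iSup_comp, Category.assoc]
      refine iSup₂_le fun r x => ?_
      exact (comp_mono (g.functor.hom_le _ _) (h x)).trans (Z.cat.comp_le _ _ _)⟩

/-- Sup-preserving `Q`-functors carry the pointwise order of `Q`-functors. -/
instance (X Y : QSup Q) : PartialOrder (Hom X Y) where
  le f g := f.functor.Le g.functor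
  le_refl f _ x := Y.cat.id_le (f.functor.map x)
  le_trans f g h k l q x := by
    have := (comp_mono (k x) (l x)).trans (Y.cat.comp_le _ _ _)
    rwa [Category.comp_id] at this
  le_antisymm f g h k := by
    ext q x
    exact Y.separated _ _ (h x) (k x)

/-- The presheaf `⋁ y ∈ T, Y(-, y)`. -/
def joinPresheaf {Y : QCat Q} {q : Q} (T : Set (Y.obj q)) : Presheaf Y q where
  val z := ⨆ y ∈ T, Y.hom z y
  comp_le z z' := by
    simp only [comp_iSup]
    exact iSup₂_le fun y hy => le_iSup₂_of_le y hy (Y.comp_le _ _ _)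

/-- The underlying join of a set of elements of the same type. -/
def join (Y : QSup Q) {q : Q} (T : Set (Y.cat.obj q)) : Y.cat.obj q := Y.sup (joinPresheaf T)

theorem le_map_join {Y Z : QSup Q} (g : Hom Y Z) {q r : Q} (T : Set (Y.cat.obj q))
    (z : Z.cat.obj r) (v : q ⟶ r) :
    v ≤ Z.cat.hom (g.functor.map (Y.join T)) z ↔
      ∀ y ∈ T, v ≤ Z.cat.hom (g.functor.map y) z := by
  rw [join, (preserves_iff g.functor).1 g.map_sup]
  constructor
  · intro h y hy
    refine le_trans ?_ (h y)
    have h1 : 𝟙 q ≤ (joinPresheaf T).val y := (Y.cat.id_le y).trans (le_iSup₂_of_le y hy le_rfl)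
    have := comp_mono h1 (le_refl v)
    rwa [Category.id_comp] at this
  · intro h p x
    change (⨆ y ∈ T, Y.cat.hom x y) ≫ v ≤ _
    simp only [iSup_comp]
    exact iSup₂_le fun y hy =>
      (comp_mono (g.functor.hom_le x y) (h y hy)).trans (Z.cat.comp_le _ _ _)

theorem le_join {Y : QSup Q} {q r : Q} (T : Set (Y.cat.obj q)) (z : Y.cat.obj r) (v : q ⟶ r) :
    v ≤ Y.cat.hom (Y.join T) z ↔ ∀ y ∈ T, v ≤ Y.cat.hom y z :=
  le_map_join (𝟙 Y) T z v

/-- The pointwise join of sup-preserving `Q`-functors. -/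
def supHom {X Y : QSup Q} (S : Set (Hom X Y)) : Hom X Y :=
  let F : QFunctor X.cat Y.cat :=
    { map := fun x => Y.join ((fun f : Hom X Y => f.functor.map x) '' S)
      hom_le := fun x x' => by
        rw [le_join]
        rintro _ ⟨f, hf, rfl⟩
        refine (f.functor.hom_le x x').trans ?_
        have h1 := (le_join ((fun f : Hom X Y => f.functor.map x') '' S) _ _).1
          (Y.cat.id_le _) _ ⟨f, hf, rfl⟩
        have := (comp_mono (le_refl (Y.cat.hom (f.functor.map x) (f.functor.map x'))) h1).trans
          (Y.cat.comp_le _ _ _)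
        rwa [Category.comp_id] at this }
  { functor := F
    map_sup := (preserves_iff F).2 fun {q r} μ y v => by
      have key : ∀ {p : Q} (x : X.cat.obj p) (w : p ⟶ r),
          w ≤ Y.cat.hom (F.map x) y ↔ ∀ f ∈ S, w ≤ Y.cat.hom (f.functor.map x) y := by
        intro p x w
        refine (le_join _ _ _).trans ?_
        rw [Set.forall_mem_image]
      simp only [key]
      constructor
      · intro h p x f hf
        exact ((preserves_iff f.functor).1 f.map_sup μ y v).1 (h f hf) x
      · intro h f hf
        exact ((preserves_iff f.functor).1 f.map_sup μ y v).2 fun x => h x f hf }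

theorem supHom_isLUB {X Y : QSup Q} (S : Set (Hom X Y)) : IsLUB S (supHom S) := by
  constructor
  · intro f hf q x
    exact (le_join _ _ _).1 (Y.cat.id_le _) _ ⟨f, hf, rfl⟩
  · intro g hg q x
    refine (le_join _ _ _).2 ?_
    rintro _ ⟨f, hf, rfl⟩
    exact hg hf x

instance homLattice (X Y : QSup Q) : CompleteLattice (X ⟶ Y) :=
  letI : PartialOrder (X ⟶ Y) := inferInstanceAs (PartialOrder (Hom X Y))
  letI : SupSet (X ⟶ Y) := ⟨fun S => supHom S⟩
  completeLatticeOfSup (X ⟶ Y) fun S => supHom_isLUB S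

/-- `Q-Sup` is a quantaloid with the pointwise order. -/
instance : Quantaloid (QSup Q) where
  comp_sSup {X Y Z} f S := by
    apply le_antisymm
    · intro q x
      refine (le_join _ _ _).2 ?_
      rintro _ ⟨g, hg, rfl⟩
      have : f ≫ g ≤ ⨆ g ∈ S, f ≫ g := le_iSup₂_of_le g hg le_rfl
      exact this x
    · refine iSup₂_le fun g hg => ?_
      intro q x
      exact (supHom_isLUB S).1 hg (f.functor.map x)
  sSup_comp {X Y Z} S g := by
    apply le_antisymm
    · intro q x
      refine (le_map_join g _ _ _).2 ?_
      rintro _ ⟨f, hf, rfl⟩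
      have : f ≫ g ≤ ⨆ f ∈ S, f ≫ g := le_iSup₂_of_le f hf le_rfl
      exact this x
    · refine iSup₂_le fun f hf => ?_
      intro q x
      exact ((supHom_isLUB S).1 hf x).trans (g.functor.hom_le _ _)

end QSup

/-! ### `Q`-closure spaces and continuous distributors -/

/-- A `Q`-functor `c : X ⟶ X` is a `Q`-closure operator if `1 ≤ c` and `c c ≤ c`. -/
structure IsClosureOperator {X : QCat Q} (c : QFunctor X X) : Prop where
  id_le : (QFunctor.id X).Le c
  comp_le : (c.comp c).Le c

variable (Q) in
/-- A `Q`-closure space: a `Q`-category `X` with a `Q`-closure operator on `PX`. -/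
structure QCls where
  cat : QCat Q
  c : QFunctor (presheafCat cat) (presheafCat cat)
  isClosure : IsClosureOperator c

namespace QCls

/-- The closure of a presheaf. -/
def close (A : QCls Q) {q : Q} (μ : Presheaf A.cat q) : Presheaf A.cat q := A.c.map μ

theorem le_close (A : QCls Q) {q : Q} (μ : Presheaf A.cat q) : μ ≤ A.close μ :=
  presheafCat_le_iff.1 (A.isClosure.id_le μ)

theorem close_mono (A : QCls Q) {q : Q} {μ ν : Presheaf A.cat q} (h : μ ≤ ν) :
    A.close μ ≤ A.close ν :=
  presheafCat_le_iff.1 (le_trans (presheafCat_le_iff.2 h) (A.c.hom_le μ ν))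

theorem close_close (A : QCls Q) {q : Q} (μ : Presheaf A.cat q) :
    A.close (A.close μ) = A.close μ :=
  le_antisymm (presheafCat_le_iff.1 (A.isClosure.comp_le μ)) (A.le_close _)

theorem presheafHom_close (A : QCls Q) {p q : Q} (μ : Presheaf A.cat p) {ν : Presheaf A.cat q}
    (hν : A.close ν = ν) : presheafHom (A.close μ) ν = presheafHom μ ν := by
  apply le_antisymm
  · exact le_presheafHom.2 fun x =>
      (comp_mono (A.le_close μ x) le_rfl).trans (le_presheafHom.1 le_rfl x)
  · have := A.c.hom_le μ ν
    change presheafHom μ ν ≤ presheafHom (A.close μ) (A.close ν) at this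
    rwa [hν] at this

/-- The `Q`-category `C(X, c)` of closed presheaves, a full `Q`-subcategory of `PX`. -/
abbrev closedCat (A : QCls Q) : QCat Q where
  obj q := {μ : Presheaf A.cat q // A.close μ = μ}
  hom μ ν := (presheafCat A.cat).hom μ.1 ν.1
  id_le μ := (presheafCat A.cat).id_le μ.1
  comp_le μ ν ξ := (presheafCat A.cat).comp_le μ.1 ν.1 ξ.1

/-- The pointwise join `⋁ μ, Φ(μ) ∘ μ` over all closed presheaves `μ`. -/
def closedJoin (A : QCls Q) {q : Q} (Φ : Presheaf A.closedCat q) : Presheaf A.cat q where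
  val x := ⨆ (r : Q) (μ : A.closedCat.obj r), μ.1.val x ≫ Φ.val μ
  comp_le x x' := by
    simp only [comp_iSup]
    refine iSup₂_le fun r μ => le_iSup₂_of_le r μ ?_
    rw [← Category.assoc]
    exact comp_mono (μ.1.comp_le x x') le_rfl

/-- `C(X, c)` as a separated complete `Q`-category. -/
abbrev closedSup (A : QCls Q) : QSup Q where
  cat := A.closedCat
  separated μ ν h k :=
    Subtype.ext (le_antisymm (presheafCat_le_iff.1 h) (presheafCat_le_iff.1 k))
  complete Φ := by
    refine ⟨⟨A.close (A.closedJoin Φ), A.close_close _⟩, QCat.isSup_iff.2 ?_⟩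
    intro r ν v
    change v ≤ presheafHom (A.close (A.closedJoin Φ)) ν.1 ↔
      ∀ {p : Q} (μ : A.closedCat.obj p), Φ.val μ ≫ v ≤ presheafHom μ.1 ν.1
    rw [A.presheafHom_close _ ν.2]
    simp only [le_presheafHom]
    constructor
    · intro h p μ s x
      refine le_trans ?_ (h x)
      rw [← Category.assoc]
      exact comp_mono (le_iSup₂_of_le p μ le_rfl) le_rfl
    · intro h s x
      change (⨆ (r : Q) (μ : A.closedCat.obj r), μ.1.val x ≫ Φ.val μ) ≫ v ≤ _
      simp only [iSup_comp, Category.assoc]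
      exact iSup₂_le fun r μ => h μ x

/-- Continuous distributors `ζ : (X, c) ⇸ (Y, d)`: distributors with `ζ^* d ≤ c ζ^*`. -/
@[ext]
structure Hom (A B : QCls Q) where
  dist : Dist A.cat B.cat
  continuous : (B.c.comp dist.star).Le (dist.star.comp A.c)

theorem continuous_iff {A B : QCls Q} (ζ : Dist A.cat B.cat) :
    (B.c.comp ζ.star).Le (ζ.star.comp A.c) ↔
      ∀ {q : Q} (l : Presheaf B.cat q), ζ.pull (B.close l) ≤ A.close (ζ.pull l) := by
  constructor
  · intro h q l
    exact presheafCat_le_iff.1 (h l)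
  · intro h q l
    exact presheafCat_le_iff.2 (h l)

theorem Hom.pull_close {A B : QCls Q} (ζ : Hom A B) {q : Q} (l : Presheaf B.cat q) :
    ζ.dist.pull (B.close l) ≤ A.close (ζ.dist.pull l) :=
  (continuous_iff ζ.dist).1 ζ.continuous l

theorem Hom.close_pull_close {A B : QCls Q} (ζ : Hom A B) {q : Q} (l : Presheaf B.cat q) :
    A.close (ζ.dist.pull (B.close l)) = A.close (ζ.dist.pull l) := by
  apply le_antisymm
  · rw [← A.close_close (ζ.dist.pull l)]
    exact A.close_mono (ζ.pull_close l)
  · exact A.close_mono (ζ.dist.pull_mono (B.le_close l))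

instance : Category.{u} (QCls Q) where
  Hom A B := Hom A B
  id A := ⟨Dist.id A.cat, (continuous_iff _).2 fun l => by
    simp only [Dist.pull_id]
    exact le_rfl⟩
  comp ζ η := ⟨ζ.dist.comp η.dist, (continuous_iff _).2 fun l => by
    simp only [Dist.pull_comp]
    refine (ζ.dist.pull_mono (η.pull_close l)).trans ?_
    exact ζ.pull_close _⟩
  id_comp {A B} ζ := Hom.ext (by
    apply le_antisymm
    · intro p q x y
      exact iSup₂_le fun r x' => ζ.dist.comp_le_left x' x y
    · intro p q x y
      refine le_iSup₂_of_le p x ?_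
      have := comp_mono (A.cat.id_le x) (le_refl (ζ.dist.rel x y))
      rwa [Category.id_comp] at this)
  comp_id {A B} ζ := Hom.ext (by
    apply le_antisymm
    · intro p q x y
      exact iSup₂_le fun r y' => ζ.dist.comp_le_right x y' y
    · intro p q x y
      refine le_iSup₂_of_le q y ?_
      have := comp_mono (le_refl (ζ.dist.rel x y)) (B.cat.id_le y)
      rwa [Category.comp_id] at this)
  assoc {A B C D} ζ η θ := Hom.ext (by
    ext p q x y
    change (⨆ (s : Q) (c : C.cat.obj s), (⨆ (r : Q) (b : B.cat.obj r),
        ζ.dist.rel x b ≫ η.dist.rel b c) ≫ θ.dist.rel c y) =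
      ⨆ (r : Q) (b : B.cat.obj r), ζ.dist.rel x b ≫ ⨆ (s : Q) (c : C.cat.obj s),
        η.dist.rel b c ≫ θ.dist.rel c y
    simp only [comp_iSup, iSup_comp, Category.assoc]
    apply le_antisymm
    · exact iSup₂_le fun s c => iSup₂_le fun r b =>
        le_iSup₂_of_le r b (le_iSup₂_of_le s c le_rfl)
    · exact iSup₂_le fun r b => iSup₂_le fun s c =>
        le_iSup₂_of_le s c (le_iSup₂_of_le r b le_rfl))

/-- Continuous distributors carry the pointwise order of distributors. -/
instance (A B : QCls Q) : PartialOrder (Hom A B) :=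
  PartialOrder.lift Hom.dist fun _ _ h => Hom.ext h

/-- The pointwise join of continuous distributors. -/
def supHom {A B : QCls Q} (S : Set (Hom A B)) : Hom A B where
  dist := Dist.sup (Hom.dist '' S)
  continuous := (continuous_iff _).2 fun {q} l => by
    refine (Dist.pull_le_iff _).2 fun {p r} x y => ?_
    change (⨆ φ ∈ Hom.dist '' S, Dist.rel φ x y) ≫ _ ≤ _
    simp only [iSup_comp]
    refine iSup₂_le ?_
    rintro _ ⟨ζ, hζ, rfl⟩
    refine (ζ.dist.le_pull _ x y).trans ((ζ.pull_close l x).trans ?_)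
    refine A.close_mono (Dist.pull_mono_left ?_ l) x
    intro p q x y
    exact le_iSup₂_of_le ζ.dist ⟨ζ, hζ, rfl⟩ le_rfl

theorem supHom_isLUB {A B : QCls Q} (S : Set (Hom A B)) : IsLUB S (supHom S) := by
  constructor
  · intro ζ hζ p q x y
    exact le_iSup₂_of_le ζ.dist ⟨ζ, hζ, rfl⟩ le_rfl
  · intro η hη p q x y
    refine iSup₂_le ?_
    rintro _ ⟨ζ, hζ, rfl⟩
    exact hη hζ x y

instance homLattice (A B : QCls Q) : CompleteLattice (A ⟶ B) :=
  letI : PartialOrder (A ⟶ B) := inferInstanceAs (PartialOrder (Hom A B))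
  letI : SupSet (A ⟶ B) := ⟨fun S => supHom S⟩
  completeLatticeOfSup (A ⟶ B) fun S => supHom_isLUB S

/-- `Q-ClsDist`, the quantaloid of `Q`-closure spaces and continuous distributors. -/
instance : Quantaloid (QCls Q) where
  comp_sSup {A B C} ζ S := by
    apply le_antisymm
    · intro p q x z
      refine iSup₂_le fun r y => ?_
      change ζ.dist.rel x y ≫ (⨆ φ ∈ Hom.dist '' S, Dist.rel φ y z) ≤ _
      simp only [comp_iSup]
      refine iSup₂_le ?_
      rintro _ ⟨η, hη, rfl⟩
      have h1 : ζ ≫ η ≤ ⨆ η ∈ S, ζ ≫ η := le_iSup₂_of_le η hη le_rfl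
      refine le_trans ?_ (h1 x z)
      exact le_iSup₂_of_le r y le_rfl
    · refine iSup₂_le fun η hη => ?_
      intro p q x z
      refine iSup₂_le fun r y => le_iSup₂_of_le r y ?_
      exact comp_mono le_rfl ((supHom_isLUB S).1 hη y z)
  sSup_comp {A B C} S η := by
    apply le_antisymm
    · intro p q x z
      refine iSup₂_le fun r y => ?_
      change (⨆ φ ∈ Hom.dist '' S, Dist.rel φ x y) ≫ η.dist.rel y z ≤ _
      simp only [iSup_comp]
      refine iSup₂_le ?_
      rintro _ ⟨ζ, hζ, rfl⟩
      have h1 : ζ ≫ η ≤ ⨆ ζ ∈ S, ζ ≫ η := le_iSup₂_of_le ζ hζ le_rfl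
      refine le_trans ?_ (h1 x z)
      exact le_iSup₂_of_le r y le_rfl
    · refine iSup₂_le fun ζ hζ => ?_
      intro p q x z
      refine iSup₂_le fun r y => le_iSup₂_of_le r y ?_
      exact comp_mono ((supHom_isLUB S).1 hζ x y) le_rfl

/-- The right adjoint `ζ_* : μ ↦ μ ↙ ζ` of `ζ^*`. -/
def push {A B : QCls Q} (ζ : Hom A B) {q : Q} (μ : Presheaf A.cat q) : Presheaf B.cat q where
  val y := ⨅ (p : Q) (x : A.cat.obj p), lda (μ.val x) (ζ.dist.rel x y)
  comp_le y y' := by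
    simp only [le_iInf_iff, le_lda]
    intro p x
    rw [← Category.assoc]
    refine (comp_mono (ζ.dist.comp_le_right x y' y) le_rfl).trans ?_
    exact le_lda.1 (iInf₂_le p x)

theorem le_presheafHom_push {A B : QCls Q} (ζ : Hom A B) {p q : Q} (l : Presheaf B.cat p)
    (μ : Presheaf A.cat q) : presheafHom (ζ.dist.pull l) μ = presheafHom l (push ζ μ) := by
  apply eq_of_forall_le_iff
  intro v
  simp only [le_presheafHom, push, le_iInf_iff, le_lda]
  constructor
  · intro h r y s x
    rw [← Category.assoc]
    exact (comp_mono (ζ.dist.le_pull l x y) le_rfl).trans (h x)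
  · intro h s x
    change (⨆ (r : Q) (y : B.cat.obj r), ζ.dist.rel x y ≫ l.val y) ≫ v ≤ _
    simp only [iSup_comp, Category.assoc]
    exact iSup₂_le fun r y => h y s x

theorem close_push {A B : QCls Q} (ζ : Hom A B) {q : Q} {μ : Presheaf A.cat q}
    (hμ : A.close μ = μ) : B.close (push ζ μ) = push ζ μ := by
  refine le_antisymm ?_ (B.le_close _)
  have adj : ∀ l : Presheaf B.cat q, l ≤ push ζ μ ↔ ζ.dist.pull l ≤ μ := by
    intro l
    rw [← presheafCat_le_iff, ← presheafCat_le_iff]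
    change _ ≤ presheafHom l (push ζ μ) ↔ _ ≤ presheafHom (ζ.dist.pull l) μ
    rw [le_presheafHom_push]
  refine (adj _).2 ((ζ.pull_close _).trans ?_)
  refine (A.close_mono ((adj _).1 le_rfl)).trans ?_
  rw [hμ]

/-- The sup-preserving `Q`-functor `ζ^▷ : C(Y, d) ⟶ C(X, c)`, `λ ↦ c (ζ^* λ)`, of a continuous
distributor `ζ : (X, c) ⇸ (Y, d)`. -/
def Hom.triangle {A B : QCls Q} (ζ : Hom A B) : QSup.Hom B.closedSup A.closedSup :=
  let F : QFunctor B.closedCat A.closedCat :=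
    { map := fun l => ⟨A.c.map (ζ.dist.star.map l.1), A.close_close _⟩
      hom_le := fun l l' => (ζ.dist.star.hom_le l.1 l'.1).trans (A.c.hom_le _ _) }
  { functor := F
    map_sup := QSup.preserves_of_adjoint (X := B.closedSup) (Y := A.closedSup) F
      (fun μ => ⟨push ζ μ.1, close_push ζ μ.2⟩)
      (fun l μ => (A.presheafHom_close _ μ.2).trans (le_presheafHom_push ζ l.1 μ.1)) }

end QCls

variable (Q) in
/-- The functor `C_d : (Q-ClsDist)^op ⥤ Q-Sup`, `(X, c) ↦ C(X, c)`, `ζ ↦ ζ^▷`. -/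
def Cd : (QCls Q)ᵒᵖ ⥤ QSup Q where
  obj A := A.unop.closedSup
  map ζ := QCls.Hom.triangle ζ.unop
  map_id A := QSup.Hom.ext (QFunctor.ext (by
    funext q l
    apply Subtype.ext
    change A.unop.close ((Dist.id A.unop.cat).pull l.1) = l.1
    rw [Dist.pull_id, l.2]))
  map_comp {A B C} η ζ := QSup.Hom.ext (QFunctor.ext (by
    funext q l
    apply Subtype.ext
    change C.unop.close ((ζ.unop.dist.comp η.unop.dist).pull l.1) =
      C.unop.close (ζ.unop.dist.pull (B.unop.close (η.unop.dist.pull l.1)))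
    rw [Dist.pull_comp, ζ.unop.close_pull_close]))

namespace QCls

/-- The closure of a continuous distributor `ζ : (X, c) ⇸ (Y, d)`: its transpose is the transpose
of `ζ` followed by `c`. -/
def clDist {A B : QCls Q} (ζ : Hom A B) : Dist A.cat B.cat :=
  Dist.ofTranspose (ζ.dist.transpose.comp A.c)

theorem le_clDist {A B : QCls Q} (ζ : Hom A B) : ζ.dist ≤ clDist ζ := by
  intro p q x y
  exact A.le_close (ζ.dist.transpose.map y) x

theorem clDist_pull_le {A B : QCls Q} (ζ : Hom A B) {q : Q} (l : Presheaf B.cat q) :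
    (clDist ζ).pull l ≤ A.close (ζ.dist.pull l) := by
  refine (Dist.pull_le_iff _).2 fun {p r} x y => ?_
  have h : l.val y ≤ presheafHom (ζ.dist.transpose.map y) (ζ.dist.pull l) :=
    le_presheafHom.2 fun x => ζ.dist.le_pull l x y
  exact le_presheafHom.1 (h.trans (A.c.hom_le _ _)) x

theorem close_clDist_pull {A B : QCls Q} (ζ : Hom A B) {q : Q} (l : Presheaf B.cat q) :
    A.close ((clDist ζ).pull l) = A.close (ζ.dist.pull l) := by
  apply le_antisymm
  · rw [← A.close_close (ζ.dist.pull l)]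
    exact A.close_mono (clDist_pull_le ζ l)
  · exact A.close_mono (Dist.pull_mono_left (le_clDist ζ) l)

/-- The closure of a continuous distributor, as a continuous distributor. -/
def clHom {A B : QCls Q} (ζ : Hom A B) : Hom A B where
  dist := clDist ζ
  continuous := (continuous_iff _).2 fun {q} l => by
    rw [close_clDist_pull, ← ζ.close_pull_close]
    exact clDist_pull_le ζ (B.close l)

variable (Q) in
/-- The nucleus `cl` on `Q-ClsDist`. Its fixed points are the closed continuous distributors. -/
def cl : Nucleus (QCls Q) where
  cl ζ := clHom ζ
  mono {A B ζ ζ'} h p q x y := by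
    refine A.close_mono (μ := ζ.dist.transpose.map y) (ν := ζ'.dist.transpose.map y) ?_ x
    intro r x
    exact h x y
  le_cl ζ := le_clDist ζ
  cl_cl {A B} ζ := Hom.ext (by
    ext p q x y
    exact congrArg (fun μ : Presheaf A.cat q => μ.val x) (A.close_close (ζ.dist.transpose.map y)))
  cl_comp_cl {A B C} ζ η p q x z := by
    have h : ∀ θ : Hom B C, ((ζ.dist.comp θ.dist).transpose.map z : Presheaf A.cat q) =
        ζ.dist.pull (θ.dist.transpose.map z) := fun θ => rfl
    change ((clDist ζ).pull (B.close (η.dist.transpose.map z))).val x ≤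
      (A.close (ζ.dist.pull (η.dist.transpose.map z))).val x
    rw [← ζ.close_pull_close]
    exact clDist_pull_le ζ _ x

/-- A continuous distributor `ζ : (X, c) ⇸ (Y, d)` is closed if its transpose sends every `y` to a
closed presheaf on `(X, c)`. -/
def Hom.Closed {A B : QCls Q} (ζ : Hom A B) : Prop :=
  ∀ {q : Q} (y : B.cat.obj q), A.close (ζ.dist.transpose.map y) = ζ.dist.transpose.map y

/-- The arrows of the quotient quantaloid of `cl` are the closed continuous distributors. -/
theorem cl_eq_self_iff {A B : QCls Q} (ζ : A ⟶ B) : (cl Q).cl ζ = ζ ↔ Hom.Closed ζ := by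
  constructor
  · intro h q y
    exact congrArg (fun η : Hom A B => (η.dist.transpose.map y : Presheaf A.cat q)) h
  · intro h
    refine Hom.ext ?_
    ext p q x y
    exact congrArg (fun μ : Presheaf A.cat q => μ.val x) (h y)

end QCls

variable (Q) in
/-- `Q-ClsCloDist`, the quotient quantaloid of `Q-ClsDist` by the nucleus `cl`: `Q`-closure spaces
and closed continuous distributors. -/
abbrev ClsCloDist : Type (u + 1) := (QCls.cl Q).Quotient

variable (Q) in
/-- The functor `C_cl : (Q-ClsCloDist)^op ⥤ Q-Sup` through which `C_d` factors. It sends a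
`Q`-closure space `(X, c)` to `C(X, c)` and a closed continuous distributor `ζ` to `ζ^▷`. -/
def Ccl : (ClsCloDist Q)ᵒᵖ ⥤ QSup Q :=
  (QCls.cl Q).liftOp (Cd Q) fun {A B} ζ => QSup.Hom.ext (QFunctor.ext (by
    funext q l
    apply Subtype.ext
    exact QCls.close_clDist_pull ζ l.1))

/-- The closure operator `c_X = y_X sup_X` on presheaves of a separated complete `Q`-category. -/
def QSup.closure (X : QSup Q) : QFunctor (presheafCat X.cat) (presheafCat X.cat) :=
  QFunctor.comp (Y := X.cat)
    { map := fun μ => X.sup μ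
      hom_le := fun _ ν => X.le_hom_sup.2 fun x =>
        (le_presheafHom.1 le_rfl x).trans (X.le_sup ν x) }
    X.cat.yoneda

theorem QSup.sup_yoneda (X : QSup Q) {q : Q} (x : X.cat.obj q) :
    X.sup (X.cat.yoneda.map x) = x := by
  refine X.sup_eq (QCat.isSup_iff.2 fun y v => ?_)
  constructor
  · intro h p z
    exact (comp_mono le_rfl h).trans (X.cat.comp_le z x y)
  · intro h
    refine le_trans ?_ (h x)
    have := comp_mono (X.cat.id_le x) (le_refl v)
    rwa [Category.id_comp] at this

/-- The `Q`-closure space `(X, c_X)` of a separated complete `Q`-category `X`. -/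
abbrev QSup.toCls (X : QSup Q) : QCls Q where
  cat := X.cat
  c := X.closure
  isClosure :=
    { id_le := fun _ μ => presheafCat_le_iff.2 fun _ x => X.le_sup μ x
      comp_le := fun _ μ => by
        refine presheafCat_le_iff.2 fun _ x => ?_
        change X.cat.hom x (X.sup (X.cat.yoneda.map (X.sup μ))) ≤ X.cat.hom x (X.sup μ)
        rw [X.sup_yoneda] }

/-- The cograph of a sup-preserving `Q`-functor `f : X ⟶ Y` is a continuous distributor from
`(Y, c_Y)` to `(X, c_X)`. -/
def QSup.Hom.cographHom {X Y : QSup Q} (f : QSup.Hom X Y) : QCls.Hom Y.toCls X.toCls where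
  dist := f.functor.cograph
  continuous := (QCls.continuous_iff _).2 fun {q} μ => by
    refine (Dist.pull_le_iff _).2 fun {p r} y x => ?_
    change Y.cat.hom y (f.functor.map x) ≫ X.cat.hom x (X.sup μ) ≤
      Y.cat.hom y (Y.sup (f.functor.cograph.star.map μ))
    rw [← f.map_sup]
    exact (comp_mono le_rfl (f.functor.hom_le _ _)).trans (Y.cat.comp_le _ _ _)

variable (Q) in
/-- The functor `I_d : Q-Sup ⥤ (Q-ClsDist)^op`, `X ↦ (X, c_X)`, `f ↦ f^♮`. -/
def Idist : QSup Q ⥤ (QCls Q)ᵒᵖ where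
  obj X := Opposite.op X.toCls
  map f := Quiver.Hom.op (X := QSup.toCls _) (Y := QSup.toCls _) (QSup.Hom.cographHom f)
  map_id _ := rfl
  map_comp {X Y Z} f g := congrArg
    (Quiver.Hom.op (X := QSup.toCls _) (Y := QSup.toCls _)) (QCls.Hom.ext (by
      apply le_antisymm
      · intro p q z x
        refine le_iSup₂_of_le q (f.functor.map x) ?_
        have := comp_mono (le_refl (Z.cat.hom z (g.functor.map (f.functor.map x))))
          (Y.cat.id_le (f.functor.map x))
        rwa [Category.comp_id] at this
      · intro p q z x
        refine iSup₂_le fun r y => ?_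
        exact (comp_mono le_rfl (g.functor.hom_le _ _)).trans (Z.cat.comp_le _ _ _)))

variable (Q) in
/-- The functor `I_cl : Q-Sup ⥤ (Q-ClsCloDist)^op`, the composite of `I_d` with the quotient
homomorphism `cl^op`. -/
def Icl : QSup Q ⥤ (ClsCloDist Q)ᵒᵖ := Idist Q ⋙ (QCls.cl Q).proj.op

end

end QClosure

/-! In `C(X, c)` the closed presheaves generated by the elements of `X` are dense: the closure of
any presheaf `l` is their supremum weighted by `l` (`sup_closedYoneda`). A sup-preserving functor `g
: C(Y, d) ⟶ C(X, c)` is therefore determined by its values on the generators `d (y_Y y)`, and these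
values are the columns of a distributor `ζ`. Since `g` preserves weighted suprema, `c (ζ^* l) = g (d
l)` for every `l` (`close_distOfSupHom_pull`). From this identity `ζ` is continuous and `ζ^▷ = g`,
while `ζ` is closed because its columns are values of `g`. So `C_cl` is full. Evaluation at the
generators also shows that `ζ^▷` and `cl ζ` determine each other, order included
(`triangle_le_triangle_iff`), so `C_cl` is an order embedding on hom-sets, hence faithful.

For a separated complete `X`, the presheaves closed under `c_X = y_X sup_X` are exactly the
representable ones, so `sup_X` and `y_X` are inverse isomorphisms between `C(X, c_X)` and `X`. They
are natural in `X`, which gives `C_cl I_cl ≅ 1`. Full faithfulness of `C_cl` then yields the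
isomorphism `1 ≅ I_cl C_cl`.

Preservation of joins needs no computation: a full functor that embeds hom-sets as ordered sets is
an order isomorphism on each of them. For `I_cl` the embedding is deduced from `C_cl I_cl ≅ 1`. -/

namespace QClosure

/-! ### Full order embeddings and joins of arrows -/

section QuantaloidHom

variable {C : Type*} [Category C] [Quantaloid C] {D : Type*} [Category D] [Quantaloid D]

/-- A full functor that is an order embedding on hom-sets preserves all joins of arrows. -/
theorem IsQuantaloidHom.of_full {F : C ⥤ D} [F.Full]
    (h : ∀ {p q : C} (u v : p ⟶ q), F.map u ≤ F.map v ↔ u ≤ v) : IsQuantaloidHom F := by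
  intro p q S
  apply le_antisymm
  · obtain ⟨w, hw⟩ := F.map_surjective (sSup ((fun u => F.map u) '' S))
    rw [← hw, h]
    refine sSup_le fun u hu => (h _ _).1 ?_
    rw [hw]
    exact le_sSup ⟨u, hu, rfl⟩
  · refine sSup_le ?_
    rintro _ ⟨u, hu, rfl⟩
    exact (h _ _).2 (le_sSup hu)

theorem faithful_of_map_le_map_iff {F : C ⥤ D}
    (h : ∀ {p q : C} (u v : p ⟶ q), F.map u ≤ F.map v ↔ u ≤ v) : F.Faithful where
  map_injective huv := le_antisymm ((h _ _).1 huv.le) ((h _ _).1 huv.ge)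

/-- Functors isomorphic to the identity are order embeddings on hom-sets. -/
theorem map_le_map_iff_of_iso_id {F : C ⥤ C} (e : F ≅ 𝟭 C) {p q : C} (u v : p ⟶ q) :
    F.map u ≤ F.map v ↔ u ≤ v := by
  constructor
  · intro h
    -- Conjugation by the components of `e` is monotone and, by naturality, turns `F.map u` into
    -- `u`.
    have := comp_mono (le_refl (e.inv.app p)) (comp_mono h (le_refl (e.hom.app q)))
    simpa using this
  · intro h
    have := comp_mono (le_refl (e.hom.app p)) (comp_mono h (le_refl (e.inv.app q)))
    have key : ∀ w : p ⟶ q, e.hom.app p ≫ w ≫ e.inv.app q = F.map w := fun w => by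
      have := e.inv.naturality w
      simp only [Functor.id_map] at this
      rw [this, Iso.hom_inv_id_app_assoc]
    rwa [key, key] at this

end QuantaloidHom

noncomputable section

variable {Q : Type u} [SmallCategory Q] [Quantaloid Q]

/-! ### The Yoneda lemma for presheaves and distributors -/

/-- The Yoneda lemma for presheaves on a `Q`-category. -/
theorem presheafHom_yoneda {X : QCat Q} {p q : Q} (x : X.obj p) (μ : Presheaf X q) :
    presheafHom (X.yoneda.map x) μ = μ.val x := by
  apply eq_of_forall_le_iff
  intro v
  rw [le_presheafHom]
  constructor
  · intro h
    have := (comp_mono (X.id_le x) (le_refl v)).trans (h x)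
    rwa [Category.id_comp] at this
  · intro h r z
    exact (comp_mono le_rfl h).trans (μ.comp_le x z)

/-- Pulling back a representable recovers a column of `φ`. This is how a distributor can be read off
from the functor it induces on presheaves. -/
theorem Dist.pull_yoneda {X Y : QCat Q} (φ : Dist X Y) {q : Q} (y : Y.obj q) :
    φ.pull (Y.yoneda.map y) = φ.transpose.map y := by
  apply le_antisymm
  · exact φ.pull_le_iff.2 fun x z => φ.comp_le_right x z y
  · intro p x
    have := (comp_mono (le_refl (φ.rel x y)) (Y.id_le y)).trans
      (φ.le_pull (Y.yoneda.map y) x y)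
    rwa [Category.comp_id] at this

/-! ### Closed presheaves as weighted suprema of generators -/

namespace QCls

/-- The closed presheaf generated by an element. -/
def closedYoneda (A : QCls Q) : QFunctor A.cat A.closedCat where
  map x := ⟨A.close (A.cat.yoneda.map x), A.close_close _⟩
  hom_le x x' := (A.cat.yoneda.hom_le x x').trans (A.c.hom_le _ _)

/-- The Yoneda lemma survives closure, because homs into a closed presheaf do not see whether their
source has been closed. -/
theorem hom_closedYoneda (A : QCls Q) {p q : Q} (x : A.cat.obj p) (μ : A.closedCat.obj q) :
    A.closedCat.hom (A.closedYoneda.map x) μ = μ.1.val x :=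
  (A.presheafHom_close _ μ.2).trans (presheafHom_yoneda x μ.1)

/-- The closure of a presheaf `l` is the supremum of the elements of the space weighted by `l`. -/
theorem sup_closedYoneda (A : QCls Q) {q : Q} (l : Presheaf A.cat q) :
    A.closedSup.sup (A.closedYoneda.cograph.pull l) = ⟨A.close l, A.close_close l⟩ := by
  refine A.closedSup.sup_eq ((isSup_cograph_iff A.closedYoneda).2 fun {r} μ v => ?_)
  change v ≤ presheafHom (A.close l) μ.1 ↔ _
  -- As `μ` is closed, `close` can be dropped from the source; what remains is the universal
  -- property of the weighted supremum, read through `hom_closedYoneda`.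
  rw [A.presheafHom_close _ μ.2]
  constructor
  · intro h p x
    rw [hom_closedYoneda]
    exact le_presheafHom.1 h x
  · intro h
    exact le_presheafHom.2 fun x => (h x).trans_eq (A.hom_closedYoneda x μ)

/-- Density in usable form: `g` preserves the supremum of `sup_closedYoneda`, so homs out of `g (c
l)` are computed from the values of `g` on generators alone. -/
theorem le_hom_map_close {A : QCls Q} {Z : QSup Q} (g : QSup.Hom A.closedSup Z) {q r : Q}
    (l : Presheaf A.cat q) (z : Z.cat.obj r) (v : q ⟶ r) :
    v ≤ Z.cat.hom (g.functor.map (⟨A.close l, A.close_close l⟩ : A.closedCat.obj q)) z ↔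
      ∀ {p : Q} (x : A.cat.obj p), l.val x ≫ v ≤
        Z.cat.hom (g.functor.map (A.closedYoneda.map x)) z := by
  rw [← sup_closedYoneda, (QSup.preserves_iff g.functor).1 g.map_sup]
  constructor
  · intro h p x
    refine le_trans (comp_mono ?_ le_rfl) (h (A.closedYoneda.map x))
    have := (comp_mono (A.closedCat.id_le (A.closedYoneda.map x)) (le_refl (l.val x))).trans
      (A.closedYoneda.cograph.le_pull l (A.closedYoneda.map x) x)
    rwa [Category.id_comp] at this
  · intro h p μ
    change (⨆ (r : Q) (x : A.cat.obj r),
      A.closedCat.hom μ (A.closedYoneda.map x) ≫ l.val x) ≫ v ≤ _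
    simp only [iSup_comp, Category.assoc]
    exact iSup₂_le fun r x =>
      (comp_mono (g.functor.hom_le _ _) (h x)).trans (Z.cat.comp_le _ _ _)

/-- The distributor `ζ : X ⇸ Y` with `ζ(-, y) = g (d (y_Y y))`, for `g : C(Y, d) ⟶ C(X, c)`. -/
def distOfSupHom {A B : QCls Q} (g : QSup.Hom B.closedSup A.closedSup) : Dist A.cat B.cat :=
  Dist.ofTranspose
    { map := fun y => (g.functor.map (B.closedYoneda.map y)).1
      hom_le := fun y y' => (B.closedYoneda.hom_le y y').trans (g.functor.hom_le _ _) }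

/-- Both sides are the supremum, weighted by `l`, of the closed presheaves `g (d (y_Y y))`: the left
by the formula for `ζ^*` followed by closure, the right because `g` preserves suprema. Fullness of
`C_cl` rests on this identity. -/
theorem close_distOfSupHom_pull {A B : QCls Q} (g : QSup.Hom B.closedSup A.closedSup) {q : Q}
    (l : Presheaf B.cat q) :
    (⟨A.close ((distOfSupHom g).pull l), A.close_close _⟩ : A.closedCat.obj q) =
      g.functor.map (⟨B.close l, B.close_close l⟩ : B.closedCat.obj q) := by
  -- The two sides have the same homs into every closed `ν`; taking `ν` to be each side in turn,
  -- separatedness makes them equal.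
  have key : ∀ {r : Q} (ν : A.closedCat.obj r) (v : q ⟶ r),
      v ≤ presheafHom (A.close ((distOfSupHom g).pull l)) ν.1 ↔
        v ≤ A.closedCat.hom
          (g.functor.map (⟨B.close l, B.close_close l⟩ : B.closedCat.obj q)) ν := by
    intro r ν v
    rw [A.presheafHom_close _ ν.2, le_hom_map_close g l ν v, le_presheafHom]
    constructor
    · intro h p y
      refine le_presheafHom.2 fun {s} x => ?_
      rw [← Category.assoc]
      exact (comp_mono ((distOfSupHom g).le_pull l x y) le_rfl).trans (h x)
    · intro h s x
      change (⨆ (r : Q) (y : B.cat.obj r), (distOfSupHom g).rel x y ≫ l.val y) ≫ v ≤ _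
      simp only [iSup_comp, Category.assoc]
      exact iSup₂_le fun r y => le_presheafHom.1 (h y) x
  apply A.closedSup.separated
  · exact (key _ _).2 (A.closedCat.id_le _)
  · exact (key _ _).1 (A.closedCat.id_le _)

/-- The closed continuous distributor with transpose `y ↦ g (d (y_Y y))`. -/
def homOfSupHom {A B : QCls Q} (g : QSup.Hom B.closedSup A.closedSup) : Hom A B where
  dist := distOfSupHom g
  continuous := (continuous_iff _).2 fun {q} l => by
    -- The identity is used at `d l` and at `l`. Its right side depends only on the closure, the
    -- same for both, so `c (ζ^* (d l)) = c (ζ^* l)`, which gives continuity.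
    have h := congrArg Subtype.val (close_distOfSupHom_pull g (B.close l))
    simp only [B.close_close l] at h
    refine (A.le_close _).trans (h.trans ?_).le
    exact (congrArg Subtype.val (close_distOfSupHom_pull g l)).symm

theorem homOfSupHom_closed {A B : QCls Q} (g : QSup.Hom B.closedSup A.closedSup) :
    (cl Q).cl (show A ⟶ B from homOfSupHom g) = homOfSupHom g :=
  (cl_eq_self_iff _).2 fun y => (g.functor.map (B.closedYoneda.map y)).2

theorem triangle_homOfSupHom {A B : QCls Q} (g : QSup.Hom B.closedSup A.closedSup) :
    (homOfSupHom g).triangle = g := by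
  refine QSup.Hom.ext (QFunctor.ext ?_)
  funext q l
  refine (close_distOfSupHom_pull g l.1).trans ?_
  exact congrArg (fun m : B.closedCat.obj q => g.functor.map m) (Subtype.ext l.2)

/-- At the generator of `y` the functor `ζ^▷` takes the value `c (ζ(-, y))`, a column of `cl ζ`;
conversely `ζ` and `cl ζ` induce the same `ζ^▷`. -/
theorem triangle_le_triangle_iff {A B : QCls Q} (ζ ζ' : Hom A B) :
    ζ.triangle ≤ ζ'.triangle ↔ clHom ζ ≤ clHom ζ' := by
  have hk : ∀ (θ : Hom A B) {q : Q} (y : B.cat.obj q),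
      (θ.triangle.functor.map (B.closedYoneda.map y)).1 = A.close (θ.dist.transpose.map y) :=
    fun θ q y => by
      -- Continuity removes the closure `d` from the generator, and the remaining representable
      -- pulls back to a column of `θ`.
      refine (θ.close_pull_close (B.cat.yoneda.map y)).trans ?_
      rw [θ.dist.pull_yoneda]
  constructor
  · intro h p q x y
    have h1 := presheafCat_le_iff.1 (h (B.closedYoneda.map y))
    rw [hk, hk] at h1
    exact h1 x
  · intro h q l
    refine presheafCat_le_iff.2 ?_
    change A.close (ζ.dist.pull l.1) ≤ A.close (ζ'.dist.pull l.1)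
    rw [← close_clDist_pull ζ, ← close_clDist_pull ζ']
    exact A.close_mono (Dist.pull_mono_left h l.1)

end QCls

/-! ### Full faithfulness of `C_cl` -/

theorem Ccl_map_le_map_iff {A B : (ClsCloDist Q)ᵒᵖ} (ζ ζ' : A ⟶ B) :
    (Ccl Q).map ζ ≤ (Ccl Q).map ζ' ↔ ζ ≤ ζ' := by
  have h := QCls.triangle_le_triangle_iff ζ.unop.1 ζ'.unop.1
  -- Arrows of the quotient are fixed by `cl`, so both closures in `triangle_le_triangle_iff`
  -- disappear.
  have h1 : QCls.clHom ζ.unop.1 = ζ.unop.1 := ζ.unop.2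
  have h2 : QCls.clHom ζ'.unop.1 = ζ'.unop.1 := ζ'.unop.2
  rw [h1, h2] at h
  exact h

instance : (Ccl Q).Faithful := faithful_of_map_le_map_iff Ccl_map_le_map_iff

instance : (Ccl Q).Full where
  map_surjective {A B} g :=
    ⟨Quiver.Hom.op (⟨QCls.homOfSupHom g, QCls.homOfSupHom_closed g⟩ : B.unop ⟶ A.unop),
      QCls.triangle_homOfSupHom g⟩

/-! ### Recovering `X` from its closure space -/

namespace QSup

variable (X : QSup Q)

/-- The closed presheaves on `(X, c_X)` are the representable ones. -/
theorem yoneda_sup {q : Q} (μ : X.toCls.closedCat.obj q) : X.cat.yoneda.map (X.sup μ.1) = μ.1 :=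
  μ.2

/-- This is the adjunction of `sup_X` (left) with `y_X` (right); restricted to closed presheaves it
becomes an isomorphism. -/
theorem hom_sup {p q : Q} (μ : Presheaf X.cat p) (y : X.cat.obj q) :
    X.cat.hom (X.sup μ) y = presheafHom μ (X.cat.yoneda.map y) :=
  eq_of_forall_le_iff fun _ => X.le_hom_sup.trans
    (le_presheafHom (ν := X.cat.yoneda.map y)).symm

theorem close_yoneda {q : Q} (x : X.cat.obj q) :
    X.toCls.close (X.cat.yoneda.map x) = X.cat.yoneda.map x :=
  congrArg (fun y : X.cat.obj q => X.cat.yoneda.map y) (X.sup_yoneda x)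

/-- The isomorphism `C(X, c_X) ≅ X` sending a closed presheaf to its supremum. -/
def closedSupIso : X.toCls.closedSup ≅ X where
  hom :=
    let F : QFunctor X.toCls.closedCat X.cat :=
      { map := fun μ => X.sup μ.1
        hom_le := fun μ ν => by
          rw [hom_sup, yoneda_sup] }
    { functor := F
      -- Supremum preservation follows from having a right adjoint, here the Yoneda embedding.
      map_sup := preserves_of_adjoint (X := X.toCls.closedSup) F
        (fun x => ⟨X.cat.yoneda.map x, X.close_yoneda x⟩) fun μ y => X.hom_sup μ.1 y }
  inv :=
    let G : QFunctor X.cat X.toCls.closedCat :=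
      { map := fun x => ⟨X.cat.yoneda.map x, X.close_yoneda x⟩
        hom_le := X.cat.yoneda.hom_le }
    { functor := G
      -- On closed presheaves `sup_X` is also right adjoint to Yoneda: a closed `μ` is represented
      -- by its supremum, so `PX(y_X x, μ) = μ x = X(x, sup μ)`.
      map_sup := preserves_of_adjoint (Y := X.toCls.closedSup) G (fun μ => X.sup μ.1)
        fun {p q} x μ => by
          refine (presheafHom_yoneda x μ.1).trans ?_
          exact congrArg (fun ν : Presheaf X.cat q => ν.val x) (X.yoneda_sup μ).symm }
  hom_inv_id := Hom.ext (QFunctor.ext (by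
    funext q μ
    exact Subtype.ext (X.yoneda_sup μ)))
  inv_hom_id := Hom.ext (QFunctor.ext (by
    funext q x
    exact X.sup_yoneda x))

end QSup

/-! ### The equivalence and the homomorphism property of `I_cl` -/

variable (Q) in
/-- The natural isomorphism `C_cl I_cl ≅ 1`. -/
def IclCclIso : Icl Q ⋙ Ccl Q ≅ 𝟭 (QSup Q) :=
  NatIso.ofComponents (fun X => X.closedSupIso) fun {X Y} f => by
    -- The closure `cl` applied by `I_cl` is invisible to `C_d`, so the plain cograph of `f` may be
    -- used instead.
    have h : (Icl Q ⋙ Ccl Q).map f = (Cd Q).map ((Idist Q).map f) :=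
      (QCls.cl Q).liftOp_map_proj (Cd Q)
        (fun ζ => QSup.Hom.ext (QFunctor.ext (by
          funext q l
          exact Subtype.ext (QCls.close_clDist_pull ζ l.1)))) ((Idist Q).map f).unop
    rw [h]
    refine QSup.Hom.ext (QFunctor.ext ?_)
    funext q μ
    -- Naturality reduces to `sup (y_Y (sup (f^→ μ))) = sup (f^→ μ) = f (sup μ)`, where the last
    -- equality is preservation of suprema by `f`.
    exact (Y.sup_yoneda _).trans (f.map_sup μ.1).symm

variable (Q) in
/-- The equivalence between `(Q-ClsCloDist)^op` and `Q-Sup`. -/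
def clsCloDistOpEquivalence : (ClsCloDist Q)ᵒᵖ ≌ QSup Q :=
  CategoryTheory.Equivalence.mk (Ccl Q) (Icl Q)
    -- The carrier of `I_cl C_cl (X, c)` is `C(X, c)` rather than `X`, so no isomorphism is written
    -- by hand: one is built after applying `C_cl`, from `C_cl I_cl ≅ 1`, and lifted along the fully
    -- faithful `C_cl`.
    (Functor.fullyFaithfulCancelRight (Ccl Q)
      ((Ccl Q).leftUnitor ≪≫ (Ccl Q).rightUnitor.symm ≪≫
        Functor.isoWhiskerLeft (Ccl Q) (IclCclIso Q).symm ≪≫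
          (Functor.associator _ _ _).symm))
    (IclCclIso Q)

/-- `C_cl` preserves and reflects the order, and the composite `C_cl I_cl`, being isomorphic to the
identity, does so too; hence so does `I_cl`. -/
theorem Icl_map_le_map_iff {X Y : QSup Q} (f g : X ⟶ Y) :
    (Icl Q).map f ≤ (Icl Q).map g ↔ f ≤ g :=
  (Ccl_map_le_map_iff _ _).symm.trans (map_le_map_iff_of_iso_id (IclCclIso Q) f g)

instance : (Icl Q).Full := inferInstanceAs (clsCloDistOpEquivalence Q).inverse.Full

end

end QClosure

/-- For every small quantaloid `Q`, the functors `C_cl` and `I_cl` are quantaloid homomorphisms and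
are the two functors of an equivalence between `(Q-ClsCloDist)^op` and `Q-Sup`. -/
theorem theorem4p12 (Q : Type u) [CategoryTheory.SmallCategory Q] [QClosure.Quantaloid Q] :
    QClosure.IsQuantaloidHom (QClosure.Ccl Q) ∧
    QClosure.IsQuantaloidHom (QClosure.Icl Q) ∧
    ∃ e : (QClosure.ClsCloDist Q)ᵒᵖ ≌ QClosure.QSup Q,
      e.functor = QClosure.Ccl Q ∧ e.inverse = QClosure.Icl Q :=
  ⟨QClosure.IsQuantaloidHom.of_full QClosure.Ccl_map_le_map_iff,
    QClosure.IsQuantaloidHom.of_full QClosure.Icl_map_le_map_iff,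
    -- `Equivalence.mk` may modify the unit to obtain the triangle identities but keeps both
    -- functors, so the two equations hold by definition.
    QClosure.clsCloDistOpEquivalence Q, rfl, rfl⟩
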